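/- Let $M\ge 1$ and let $\mathcal{H}_1,\dots,\mathcal{H}_M$ be separable Hilbert spaces. Write $\mathcal{M}(X)$ for the set of Borel probability measures on $X$, and for $\nu,\mu\in\mathcal{M}(X)$ let $D_{\mathrm{KL}}(\nu\|\mu)=\int_X \frac{d\nu}{d\mu}\log\frac{d\nu}{d\mu}\,d\mu$ (with $0\log 0=0$) if $\nu\ll\mu$, and $D_{\mathrm{KL}}(\nu\|\mu)=+\infty$ otherwise. For $i=1,\dots,M$ let $\mathcal{A}_i\subset\mathcal{M}(\mathcal{H}_i)$ be closed with respect to weak convergence of probability measures, that is, the limit of every weakly convergent sequence of elements of $\mathcal{A}_i$ (with limit in $\mathcal{M}(\mathcal{H}_i)$) belongs to $\mathcal{A}_i$. Let $\mu\in\mathcal{M}\big(\prod_{i=1}^M\mathcal{H}_i\big)$, and assume that there exist $\nu^i\in\mathcal{A}_i$, $i=1,\dots,M$, such that the product measure satisfies $D_{\mathrm{KL}}\big(\prod_{i=1}^M\nu^i\,\big\|\,\mu\big)<\infty$. Then the problem $$\operatorname*{arg\,min}_{\nu^i\in\mathcal{A}_i,\ i=1,\dots,M} D_{\mathrm{KL}}\Big(\prod_{i=1}^M\nu^i\,\Big\|\,\mu\Big)$$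 has a minimizer: there exist $\nu_*^i\in\mathcal{A}_i$, $i=1,\dots,M$, such that $D_{\mathrm{KL}}\big(\prod_{i}\nu_*^i\,\big\|\,\mu\big)\le D_{\mathrm{KL}}\big(\prod_{i}\nu^i\,\big\|\,\mu\big)$ for all $\nu^i\in\mathcal{A}_i$, $i=1,\dots,M$. -/

import Mathlib

open MeasureTheory InformationTheory
open scoped ENNReal

/-- A set of Borel probability measures is closed with respect to weak convergence if it contains
every probability measure that is the weak limit of a sequence of its elements. The topology on
`ProbabilityMeasure X` is that of weak convergence, tested on bounded continuous functions. -/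
def WeaklyClosed {X : Type*} [TopologicalSpace X] [MeasurableSpace X] [OpensMeasurableSpace X]
    (A : Set (ProbabilityMeasure X)) : Prop :=
  IsSeqClosed A

/-- The objective of the mean-field problem: the Kullback-Leibler divergence from the product
measure of the family `ν` to `μ`. -/
noncomputable def meanFieldKL {M : ℕ} {H : Fin M → Type*} [∀ i, MeasurableSpace (H i)]
    (μ : ProbabilityMeasure (∀ i, H i)) (ν : ∀ i, ProbabilityMeasure (H i)) : ℝ≥0∞ :=
  klDiv (ProbabilityMeasure.pi ν : Measure (∀ i, H i)) (μ : Measure (∀ i, H i))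

/-!
This is the direct method of the calculus of variations. On a Polish space, the divergence
`ν ↦ klDiv ν μ` is lower semicontinuous for weak convergence and its sublevel sets are tight; both
facts come from the variational formula of Donsker and Varadhan, in the form

  `klDiv ν μ ≤ L ↔ ∀ f, ∫ f ∂ν ≤ L + ∫ (exp f - 1) ∂μ`.

The forward direction, for bounded measurable `f`, integrates the Young inequality
`r * t ≤ klFun r + (exp t - 1)` at `r = dν/dμ` (`integral_le_of_klDiv_le`). Applied to multiples of
indicators, it bounds `ν Kᶜ` uniformly over a sublevel set, whence tightness
(`isTightMeasureSet_klDiv_le`). Conversely, testing with truncations of `log (dν/dμ)` and Fatou's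
lemma recover the divergence (`klDiv_le_of_forall_integral_le`), and by density in `L¹(μ + ν)` it is
enough to test with bounded continuous `f`. A sublevel set is then an intersection of weakly closed
half-spaces (`lowerSemicontinuous_klDiv`).

The product map `ν ↦ ∏ ν i` is weakly continuous, so the mean-field objective is lower
semicontinuous in the family of factors. By the data processing inequality a bound on the objective
bounds the divergence of each factor from the corresponding marginal of `μ`, so Prokhorov's theorem
makes the sublevel sets of the objective compact (`isCompact_meanFieldKL_le`). Since the spaces of
probability measures are metrizable, the sequentially closed sets `A i` are closed, and a lower
semicontinuous function attains its minimum on a nonempty compact set.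
-/

open Set Filter Topology BoundedContinuousFunction

/-! ### Elementary inequalities -/

/-- Young's inequality for the convex conjugate pair `klFun` and `t ↦ exp t - 1`. -/
lemma le_klFun_add_exp_sub_one {r : ℝ} (hr : 0 ≤ r) (t : ℝ) :
    r * t ≤ klFun r + (Real.exp t - 1) := by
  rw [klFun_apply]
  rcases hr.eq_or_lt with rfl | hr
  · simpa using Real.exp_nonneg t
  · have h := Real.add_one_le_exp (t - Real.log r)
    rw [Real.exp_sub, Real.exp_log hr, le_div_iff₀ hr] at h
    linarith

lemma exp_sub_exp_le {a b B : ℝ} (ha : a ≤ B) :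
    Real.exp a - Real.exp b ≤ Real.exp B * |b - a| := by
  have h := Real.add_one_le_exp (b - a)
  rw [Real.exp_sub, le_div_iff₀ (Real.exp_pos a)] at h
  calc Real.exp a - Real.exp b ≤ Real.exp a * (a - b) := by linarith
    _ ≤ Real.exp a * |b - a| := by
      gcongr
      rw [abs_sub_comm]
      exact le_abs_self _
    _ ≤ Real.exp B * |b - a| := by gcongr

lemma integrable_of_forall_abs_le {X : Type*} [MeasurableSpace X] {μ : Measure X}
    [IsFiniteMeasure μ] {f : X → ℝ} (hf : Measurable f) {B : ℝ} (hB : ∀ x, |f x| ≤ B) :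
    Integrable f μ :=
  .of_bound hf.aestronglyMeasurable B (ae_of_all _ hB)

lemma integrable_exp_of_forall_abs_le {X : Type*} [MeasurableSpace X] {μ : Measure X}
    [IsFiniteMeasure μ] {f : X → ℝ} (hf : Measurable f) {B : ℝ} (hB : ∀ x, |f x| ≤ B) :
    Integrable (fun x ↦ Real.exp (f x)) μ :=
  integrable_of_forall_abs_le hf.exp (B := Real.exp B) fun x ↦ by
    rw [Real.abs_exp]
    exact Real.exp_le_exp.2 ((le_abs_self _).trans (hB x))

lemma integrable_exp_sub_one {X : Type*} [MeasurableSpace X] {μ : Measure X}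
    [IsFiniteMeasure μ] {f : X → ℝ} (hf : Measurable f) {B : ℝ} (hB : ∀ x, |f x| ≤ B) :
    Integrable (fun x ↦ Real.exp (f x) - 1) μ :=
  (integrable_exp_of_forall_abs_le hf hB).sub (integrable_const 1)

/-! ### The Donsker–Varadhan variational formula -/

section Variational

variable {X : Type*} [MeasurableSpace X] {μ ν : Measure X} [IsFiniteMeasure ν]

/-- Testing with the multiples `c • 1_S` of the indicator of a `μ`-null set `S` gives `c * ν S ≤ L`
for every `c`, so `ν S = 0`. -/
theorem absolutelyContinuous_of_forall_integral_le {L : ℝ}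
    (h : ∀ (f : X → ℝ) (B : ℝ), Measurable f → (∀ x, |f x| ≤ B) →
      ∫ x, f x ∂ν ≤ L + ∫ x, (Real.exp (f x) - 1) ∂μ) :
    ν ≪ μ := by
  refine Measure.AbsolutelyContinuous.mk fun S hS hμS ↦ ?_
  have key (c : ℝ) : c * ν.real S ≤ L := by
    have := h (S.indicator fun _ ↦ c) |c| (measurable_const.indicator hS) fun x ↦ by
      by_cases hx : x ∈ S <;> simp [hx]
    have h2 : (fun x ↦ Real.exp (S.indicator (fun _ ↦ c) x) - 1) =
        S.indicator fun _ ↦ Real.exp c - 1 := by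
      ext x
      by_cases hx : x ∈ S <;> simp [hx]
    rw [h2, integral_indicator_const _ hS, integral_indicator_const _ hS] at this
    simpa [mul_comm, measureReal_def, hμS] using this
  rw [← measureReal_eq_zero_iff]
  by_contra hne
  have hpos : 0 < ν.real S := lt_of_le_of_ne measureReal_nonneg (Ne.symm hne)
  have := key ((L + 1) / ν.real S)
  rw [div_mul_cancel₀ _ hne] at this
  linarith

variable [IsFiniteMeasure μ]

/-- The easy half of the Donsker–Varadhan formula: `klDiv ν μ` dominates `∫ f ∂ν - ∫ (exp f - 1) ∂μ`
for bounded measurable `f`. -/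
theorem integral_le_of_klDiv_le {L : ℝ} (hL : 0 ≤ L) (h : klDiv ν μ ≤ ENNReal.ofReal L)
    {f : X → ℝ} (hf : Measurable f) {B : ℝ} (hB : ∀ x, |f x| ≤ B) :
    ∫ x, f x ∂ν ≤ L + ∫ x, (Real.exp (f x) - 1) ∂μ := by
  obtain ⟨hac, hint⟩ := klDiv_ne_top_iff.1 (h.trans_lt ENNReal.ofReal_lt_top).ne
  have hkl : ∫ x, klFun (ν.rnDeriv μ x).toReal ∂μ ≤ L := by
    rw [← toReal_klDiv_eq_integral_klFun hac]
    exact ENNReal.toReal_le_of_le_ofReal hL h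
  have hklint := (integrable_klFun_rnDeriv_iff hac).2 hint
  have hfint : Integrable (fun x ↦ (ν.rnDeriv μ x).toReal * f x) μ :=
    (integrable_rnDeriv_smul_iff hac).2 (integrable_of_forall_abs_le hf hB)
  have hexp := integrable_exp_sub_one (μ := μ) hf hB
  calc ∫ x, f x ∂ν = ∫ x, (ν.rnDeriv μ x).toReal * f x ∂μ := (integral_rnDeriv_smul hac).symm
    _ ≤ ∫ x, (klFun (ν.rnDeriv μ x).toReal + (Real.exp (f x) - 1)) ∂μ :=
      integral_mono hfint (hklint.add hexp)
        fun x ↦ le_klFun_add_exp_sub_one ENNReal.toReal_nonneg _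
    _ = ∫ x, klFun (ν.rnDeriv μ x).toReal ∂μ + ∫ x, (Real.exp (f x) - 1) ∂μ :=
      integral_add hklint hexp
    _ ≤ L + ∫ x, (Real.exp (f x) - 1) ∂μ := by gcongr

/-- The variational inequality for `f = c • 1_S`: sets of small `μ`-measure have uniformly small
`ν`-measure over a sublevel set of the divergence. -/
theorem mul_measureReal_le_of_klDiv_le {L : ℝ} (hL : 0 ≤ L) (h : klDiv ν μ ≤ ENNReal.ofReal L)
    {S : Set X} (hS : MeasurableSet S) (c : ℝ) :
    c * ν.real S ≤ L + (Real.exp c - 1) * μ.real S := by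
  have key := integral_le_of_klDiv_le hL h (f := S.indicator fun _ ↦ c)
    (measurable_const.indicator hS) (B := |c|) fun x ↦ by
      by_cases hx : x ∈ S <;> simp [hx]
  have h2 : (fun x ↦ Real.exp (S.indicator (fun _ ↦ c) x) - 1)
      = S.indicator fun _ ↦ Real.exp c - 1 := by
    ext x
    by_cases hx : x ∈ S <;> simp [hx]
  rw [h2, integral_indicator_const _ hS, integral_indicator_const _ hS] at key
  simpa [mul_comm] using key

/-- `expClamp n r` is the truncation of `r` to the interval `[exp (-n), exp n]`. -/
noncomputable def expClamp (n : ℕ) (r : ℝ) : ℝ :=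
  max (Real.exp (-n)) (min (Real.exp n) r)

lemma expClamp_pos (n : ℕ) (r : ℝ) : 0 < expClamp n r :=
  (Real.exp_pos _).trans_le (le_max_left _ _)

lemma measurable_expClamp (n : ℕ) : Measurable (expClamp n) := by
  unfold expClamp
  fun_prop

lemma abs_log_expClamp_le (n : ℕ) (r : ℝ) : |Real.log (expClamp n r)| ≤ n := by
  rw [abs_le]
  constructor
  · rw [Real.le_log_iff_exp_le (expClamp_pos n r)]
    exact le_max_left _ _
  · rw [Real.log_le_iff_le_exp (expClamp_pos n r)]
    refine max_le (Real.exp_le_exp.2 ?_) (min_le_left _ _)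
    have : (0 : ℝ) ≤ n := n.cast_nonneg
    linarith

lemma tendsto_expClamp {r : ℝ} (hr : 0 ≤ r) :
    Tendsto (fun n ↦ expClamp n r) atTop (𝓝 r) := by
  have hexp : Tendsto (fun n : ℕ ↦ Real.exp n) atTop atTop :=
    Real.tendsto_exp_atTop.comp tendsto_natCast_atTop_atTop
  have hmin : Tendsto (fun n : ℕ ↦ min (Real.exp n) r) atTop (𝓝 r) :=
    tendsto_const_nhds.congr' <| (hexp.eventually_ge_atTop r).mono fun n hn ↦
      (min_eq_right hn).symm
  have hneg : Tendsto (fun n : ℕ ↦ Real.exp (-n)) atTop (𝓝 0) :=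
    Real.tendsto_exp_neg_atTop_nhds_zero.comp tendsto_natCast_atTop_atTop
  simpa [expClamp, max_eq_right hr] using hneg.max hmin

/-- With `c = expClamp n r`, the difference of the two sides is `(r - c) * log c`: both factors are
`≥ 0` if the truncation acts from above and `≤ 0` if it acts from below. -/
lemma klFun_expClamp_le (n : ℕ) (r : ℝ) :
    klFun (expClamp n r) ≤ r * Real.log (expClamp n r) - (expClamp n r - 1) := by
  have hn : (0 : ℝ) ≤ n := n.cast_nonneg
  suffices 0 ≤ (r - expClamp n r) * Real.log (expClamp n r) by
    rw [klFun_apply]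
    linarith
  rcases le_or_gt r (Real.exp (-n)) with h | h
  · have hc : expClamp n r = Real.exp (-n) := max_eq_left ((min_le_right _ _).trans h)
    rw [hc, Real.log_exp]
    exact mul_nonneg_of_nonpos_of_nonpos (by linarith) (by linarith)
  rcases le_or_gt r (Real.exp n) with h' | h'
  · have hc : expClamp n r = r := by rw [expClamp, min_eq_right h', max_eq_right h.le]
    simp [hc]
  · have hc : expClamp n r = Real.exp n := by
      rw [expClamp, min_eq_left h'.le, max_eq_right (Real.exp_le_exp.2 (by linarith))]
    rw [hc, Real.log_exp]
    exact mul_nonneg (by linarith) hn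

/-- The converse half of the Donsker–Varadhan formula: the test functions
`log (expClamp n (dν/dμ))` recover the divergence in the limit `n → ∞`, by Fatou's lemma. -/
theorem klDiv_le_of_forall_integral_le {L : ℝ}
    (h : ∀ (f : X → ℝ) (B : ℝ), Measurable f → (∀ x, |f x| ≤ B) →
      ∫ x, f x ∂ν ≤ L + ∫ x, (Real.exp (f x) - 1) ∂μ) :
    klDiv ν μ ≤ ENNReal.ofReal L := by
  have hac := absolutelyContinuous_of_forall_integral_le h
  rw [klDiv_eq_lintegral_klFun_of_ac hac]
  set r : X → ℝ := fun x ↦ (ν.rnDeriv μ x).toReal with hr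
  have hrm : Measurable r := (Measure.measurable_rnDeriv ν μ).ennreal_toReal
  have hcm (n : ℕ) : Measurable fun x ↦ expClamp n (r x) := (measurable_expClamp n).comp hrm
  have hbound (n : ℕ) : ∫⁻ x, ENNReal.ofReal (klFun (expClamp n (r x))) ∂μ ≤ ENNReal.ofReal L := by
    have hfm : Measurable fun x ↦ Real.log (expClamp n (r x)) := (hcm n).log
    have hfB (x : X) := abs_log_expClamp_le n (r x)
    have hfint : Integrable (fun x ↦ r x * Real.log (expClamp n (r x))) μ :=
      (integrable_rnDeriv_smul_iff hac).2 (integrable_of_forall_abs_le hfm hfB)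
    have hexp := integrable_exp_sub_one (μ := μ) hfm hfB
    have key := h _ n hfm hfB
    rw [← integral_rnDeriv_smul hac] at key
    simp only [Real.exp_log (expClamp_pos n _), smul_eq_mul] at key hexp
    calc ∫⁻ x, ENNReal.ofReal (klFun (expClamp n (r x))) ∂μ
        ≤ ∫⁻ x, ENNReal.ofReal (r x * Real.log (expClamp n (r x)) - (expClamp n (r x) - 1)) ∂μ := by
          gcongr with x
          exact klFun_expClamp_le n (r x)
      _ = ENNReal.ofReal
            (∫ x, (r x * Real.log (expClamp n (r x)) - (expClamp n (r x) - 1)) ∂μ) :=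
          (ofReal_integral_eq_lintegral_ofReal (hfint.sub hexp) <| ae_of_all _ fun x ↦
            (klFun_nonneg (expClamp_pos n _).le).trans (klFun_expClamp_le n (r x))).symm
      _ ≤ ENNReal.ofReal L := by
          rw [integral_sub hfint hexp]
          exact ENNReal.ofReal_le_ofReal (by linarith)
  calc ∫⁻ x, ENNReal.ofReal (klFun (r x)) ∂μ
      = ∫⁻ x, liminf (fun n ↦ ENNReal.ofReal (klFun (expClamp n (r x)))) atTop ∂μ := by
        congr with x
        refine (Tendsto.liminf_eq ?_).symm
        exact (ENNReal.continuous_ofReal.comp continuous_klFun).continuousAt.tendsto.comp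
          (tendsto_expClamp ENNReal.toReal_nonneg)
    _ ≤ liminf (fun n ↦ ∫⁻ x, ENNReal.ofReal (klFun (expClamp n (r x))) ∂μ) atTop :=
        lintegral_liminf_le fun n ↦ (measurable_klFun.comp (hcm n)).ennreal_ofReal
    _ ≤ ENNReal.ofReal L :=
        liminf_le_of_le (by isBoundedDefault) fun b hb ↦
          let ⟨n, hn⟩ := hb.exists
          hn.trans (hbound n)

/-- The variational inequality passes from bounded continuous to bounded measurable functions `f`:
approximate `f` in `L¹(μ + ν)` and truncate the approximation at the bound of `f`, on whose range
`exp` is Lipschitz. -/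
theorem integral_le_of_forall_boundedContinuous [TopologicalSpace X] [NormalSpace X] [BorelSpace X]
    [(μ + ν).WeaklyRegular] {L : ℝ}
    (h : ∀ g : X →ᵇ ℝ, ∫ x, g x ∂ν ≤ L + ∫ x, (Real.exp (g x) - 1) ∂μ)
    {f : X → ℝ} (hf : Measurable f) {B : ℝ} (hB : ∀ x, |f x| ≤ B) :
    ∫ x, f x ∂ν ≤ L + ∫ x, (Real.exp (f x) - 1) ∂μ := by
  refine le_of_forall_pos_le_add fun δ hδ ↦ ?_
  have hK : 0 < Real.exp B + 1 := by positivity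
  obtain ⟨g₀, hg₀, hg₀int⟩ := (integrable_of_forall_abs_le (μ := μ + ν) hf hB)
    |>.exists_boundedContinuous_integral_sub_le (ε := δ / (Real.exp B + 1)) (by positivity)
  have hclamp (x : X) : |max (-B) (min B (g₀ x))| ≤ B := by
    have hB0 : 0 ≤ B := (abs_nonneg _).trans (hB x)
    exact abs_le.2 ⟨le_max_left _ _, max_le (by linarith) (min_le_left _ _)⟩
  let g : X →ᵇ ℝ := BoundedContinuousFunction.ofNormedAddCommGroup
    (fun x ↦ max (-B) (min B (g₀ x))) (by fun_prop) B hclamp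
  have hgB (x : X) : |g x| ≤ B := hclamp x
  have hgm : Measurable g := g.continuous.measurable
  have hfg (x : X) : |f x - g x| ≤ |f x - g₀ x| := by
    obtain ⟨h1, h2⟩ := abs_le.1 (hB x)
    calc |f x - g x| = |max (-B) (min B (f x)) - max (-B) (min B (g₀ x))| := by
          rw [min_eq_right h2, max_eq_right h1]
          rfl
      _ ≤ |min B (f x) - min B (g₀ x)| := by simpa using abs_max_sub_max_le_max (-B) _ (-B) _
      _ ≤ |f x - g₀ x| := by simpa using abs_min_sub_min_le_max B (f x) B (g₀ x)
  have hfgint (m : Measure X) [IsFiniteMeasure m] : Integrable (fun x ↦ |f x - g x|) m :=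
    ((integrable_of_forall_abs_le hf hB).sub (integrable_of_forall_abs_le hgm hgB)).abs
  have hsum : ∫ x, |f x - g x| ∂μ + ∫ x, |f x - g x| ∂ν ≤ δ / (Real.exp B + 1) := by
    rw [← integral_add_measure (hfgint μ) (hfgint ν)]
    refine (integral_mono (hfgint _) ?_ hfg).trans hg₀
    exact ((integrable_of_forall_abs_le hf hB).sub hg₀int).abs
  have hν : ∫ x, f x ∂ν ≤ ∫ x, g x ∂ν + ∫ x, |f x - g x| ∂ν := by
    rw [← integral_add (integrable_of_forall_abs_le hgm hgB) (hfgint ν)]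
    refine integral_mono (integrable_of_forall_abs_le hf hB)
      ((integrable_of_forall_abs_le hgm hgB).add (hfgint ν)) fun x ↦ ?_
    have := le_abs_self (f x - g x)
    simp only
    linarith
  have hμ : ∫ x, (Real.exp (g x) - 1) ∂μ ≤
      ∫ x, (Real.exp (f x) - 1) ∂μ + Real.exp B * ∫ x, |f x - g x| ∂μ := by
    rw [← integral_const_mul,
      ← integral_add (integrable_exp_sub_one hf hB) ((hfgint μ).const_mul _)]
    refine integral_mono (integrable_exp_sub_one hgm hgB)
      ((integrable_exp_sub_one hf hB).add ((hfgint μ).const_mul _)) fun x ↦ ?_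
    have := exp_sub_exp_le (b := f x) ((le_abs_self _).trans (hgB x))
    simp only
    linarith
  have h1 : 0 ≤ ∫ x, |f x - g x| ∂μ := integral_nonneg fun x ↦ abs_nonneg _
  have h2 : 0 ≤ Real.exp B * ∫ x, |f x - g x| ∂ν :=
    mul_nonneg (Real.exp_pos B).le (integral_nonneg fun x ↦ abs_nonneg _)
  rw [le_div_iff₀ hK] at hsum
  linarith [h g]

end Variational

/-! ### Lower semicontinuity and tightness -/

section Topological

variable {X : Type*} [TopologicalSpace X] [TopologicalSpace.PseudoMetrizableSpace X]
  [MeasurableSpace X] [BorelSpace X]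

theorem klDiv_le_ofReal_iff_forall_boundedContinuous {μ ν : Measure X} [IsFiniteMeasure μ]
    [IsFiniteMeasure ν] {L : ℝ} (hL : 0 ≤ L) :
    klDiv ν μ ≤ ENNReal.ofReal L ↔
      ∀ g : X →ᵇ ℝ, ∫ x, g x ∂ν ≤ L + ∫ x, (Real.exp (g x) - 1) ∂μ := by
  refine ⟨fun h g ↦ integral_le_of_klDiv_le hL h g.continuous.measurable g.norm_coe_le_norm,
    fun h ↦ klDiv_le_of_forall_integral_le fun f B hf hB ↦ ?_⟩
  exact integral_le_of_forall_boundedContinuous h hf hB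

theorem lowerSemicontinuous_klDiv (μ : Measure X) [IsFiniteMeasure μ] :
    LowerSemicontinuous fun ν : ProbabilityMeasure X ↦ klDiv (ν : Measure X) μ := by
  rw [lowerSemicontinuous_iff_isClosed_preimage]
  intro C
  rcases eq_or_ne C ∞ with rfl | hC
  · simp
  have : (fun ν : ProbabilityMeasure X ↦ klDiv (ν : Measure X) μ) ⁻¹' Iic C =
      ⋂ g : X →ᵇ ℝ, {ν : ProbabilityMeasure X | ∫ x, g x ∂(ν : Measure X) ≤
        C.toReal + ∫ x, (Real.exp (g x) - 1) ∂μ} := by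
    ext ν
    rw [mem_preimage, mem_Iic, ← ENNReal.ofReal_toReal hC,
      klDiv_le_ofReal_iff_forall_boundedContinuous ENNReal.toReal_nonneg]
    simp [ENNReal.toReal_ofReal]
  rw [this]
  exact isClosed_iInter fun g ↦ isClosed_le
    (ProbabilityMeasure.continuous_integral_boundedContinuousFunction g) continuous_const

end Topological

/-- The sublevel sets of the divergence from a tight measure are tight. -/
theorem isTightMeasureSet_klDiv_le {X : Type*} [TopologicalSpace X] [T2Space X] [MeasurableSpace X]
    [BorelSpace X] {μ : Measure X} [IsFiniteMeasure μ] (hμ : IsTightMeasureSet {μ})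
    {C : ℝ≥0∞} (hC : C ≠ ∞) :
    IsTightMeasureSet {ν : Measure X | IsFiniteMeasure ν ∧ klDiv ν μ ≤ C} := by
  rw [isTightMeasureSet_iff_exists_isCompact_measure_compl_le] at hμ ⊢
  intro ε hε
  rcases eq_or_ne ε ∞ with rfl | hε'
  · exact ⟨∅, isCompact_empty, by simp⟩
  set e := ε.toReal with he
  have he0 : 0 < e := ENNReal.toReal_pos hε.ne' hε'
  set L := C.toReal with hL
  have hL0 : 0 ≤ L := ENNReal.toReal_nonneg
  set c := (L + 1) / e with hc
  have hc0 : 0 < c := by positivity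
  -- On `Kᶜ` the inequality `c * ν Kᶜ ≤ L + (exp c - 1) * μ Kᶜ` then reads `c * ν Kᶜ ≤ L + 1 = c * e`.
  obtain ⟨K, hK, hμK⟩ := hμ (ENNReal.ofReal (Real.exp (-c))) (by simp [Real.exp_pos])
  refine ⟨K, hK, fun ν ⟨hν, hνC⟩ ↦ ?_⟩
  have hμK' : μ.real Kᶜ ≤ Real.exp (-c) :=
    ENNReal.toReal_le_of_le_ofReal (Real.exp_pos _).le (hμK μ rfl)
  have key := mul_measureReal_le_of_klDiv_le hL0 (hνC.trans (ENNReal.ofReal_toReal hC).ge)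
    hK.isClosed.measurableSet.compl c
  have h1 : (Real.exp c - 1) * μ.real Kᶜ ≤ 1 := by
    calc (Real.exp c - 1) * μ.real Kᶜ ≤ Real.exp c * μ.real Kᶜ := by gcongr; linarith
      _ ≤ Real.exp c * Real.exp (-c) := by gcongr
      _ = 1 := by rw [← Real.exp_add, add_neg_cancel, Real.exp_zero]
  have h2 : ν.real Kᶜ ≤ e := by
    refine le_of_mul_le_mul_left ?_ hc0
    calc c * ν.real Kᶜ ≤ L + 1 := by linarith
      _ = c * e := by rw [hc, div_mul_cancel₀ _ he0.ne']
  exact (ENNReal.le_ofReal_iff_toReal_le (measure_ne_top ν _) he0.le).2 h2 |>.trans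
    (ENNReal.ofReal_toReal hε').le

/-! ### The mean-field problem -/

theorem lowerSemicontinuous_meanFieldKL {M : ℕ} {H : Fin M → Type*} [∀ i, TopologicalSpace (H i)]
    [∀ i, PolishSpace (H i)] [∀ i, MeasurableSpace (H i)] [∀ i, BorelSpace (H i)]
    (μ : ProbabilityMeasure (∀ i, H i)) :
    LowerSemicontinuous (meanFieldKL μ) :=
  (lowerSemicontinuous_klDiv (μ : Measure (∀ i, H i))).comp ProbabilityMeasure.continuous_pi

/-- The `i`-th factor of a product measure is its `i`-th marginal, so by data processing it lies in a
tight sublevel set of the divergence from the `i`-th marginal of `μ`. -/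
theorem isCompact_meanFieldKL_le {M : ℕ} {H : Fin M → Type*} [∀ i, TopologicalSpace (H i)]
    [∀ i, PolishSpace (H i)] [∀ i, MeasurableSpace (H i)] [∀ i, BorelSpace (H i)]
    (μ : ProbabilityMeasure (∀ i, H i)) {C : ℝ≥0∞} (hC : C ≠ ∞) :
    IsCompact {ν : ∀ i, ProbabilityMeasure (H i) | meanFieldKL μ ν ≤ C} := by
  have hcomp (i : Fin M) : IsCompact (closure {ν : ProbabilityMeasure (H i) |
      klDiv (ν : Measure (H i)) ((μ : Measure (∀ i, H i)).map (Function.eval i)) ≤ C}) := by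
    refine isCompact_closure_of_isTightMeasureSet <|
      (isTightMeasureSet_klDiv_le (isTightMeasureSet_singleton
        (μ := (μ : Measure (∀ i, H i)).map (Function.eval i))) hC).subset ?_
    rintro _ ⟨ν, hν, rfl⟩
    exact ⟨inferInstance, hν⟩
  refine (isCompact_univ_pi hcomp).of_isClosed_subset
    ((lowerSemicontinuous_meanFieldKL μ).isClosed_preimage C) fun ν hν i _ ↦ subset_closure ?_
  calc klDiv (ν i : Measure (H i)) ((μ : Measure (∀ i, H i)).map (Function.eval i))
      = klDiv ((Measure.pi fun j ↦ (ν j : Measure (H j))).map (Function.eval i))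
          ((μ : Measure (∀ i, H i)).map (Function.eval i)) := by
        rw [(measurePreserving_eval (fun j ↦ (ν j : Measure (H j))) i).map_eq]
    _ ≤ meanFieldKL μ ν := klDiv_map_le _ _ (measurable_pi_apply i)
    _ ≤ C := hν

theorem theorem3 {𝕜 : Type*} [RCLike 𝕜] {M : ℕ} {H : Fin M → Type*}
    [∀ i, NormedAddCommGroup (H i)] [∀ i, InnerProductSpace 𝕜 (H i)]
    [∀ i, CompleteSpace (H i)] [∀ i, TopologicalSpace.SeparableSpace (H i)]
    [∀ i, MeasurableSpace (H i)] [∀ i, BorelSpace (H i)]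
    (A : ∀ i, Set (ProbabilityMeasure (H i))) (hA : ∀ i, WeaklyClosed (A i))
    (μ : ProbabilityMeasure (∀ i, H i))
    (hfin : ∃ ν : ∀ i, ProbabilityMeasure (H i), (∀ i, ν i ∈ A i) ∧ meanFieldKL μ ν < ∞) :
    ∃ ν : ∀ i, ProbabilityMeasure (H i), (∀ i, ν i ∈ A i) ∧
      ∀ ν' : ∀ i, ProbabilityMeasure (H i), (∀ i, ν' i ∈ A i) →
        meanFieldKL μ ν ≤ meanFieldKL μ ν' := by
  have (i : Fin M) : SecondCountableTopology (H i) := UniformSpace.secondCountable_of_separable _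
  obtain ⟨ν₀, hν₀A, hν₀⟩ := hfin
  have hAc : IsClosed (univ.pi A) := isClosed_set_pi fun i _ ↦ (hA i).isClosed
  obtain ⟨ν, ⟨hνA, hνle⟩, hν⟩ := LowerSemicontinuousOn.exists_isMinOn
    (s := univ.pi A ∩ {ν | meanFieldKL μ ν ≤ meanFieldKL μ ν₀}) (f := meanFieldKL μ)
    ⟨ν₀, fun i _ ↦ hν₀A i, le_refl (meanFieldKL μ ν₀)⟩ ((isCompact_meanFieldKL_le μ hν₀.ne).inter_left hAc)
    ((lowerSemicontinuous_meanFieldKL μ).lowerSemicontinuousOn _)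
  refine ⟨ν, fun i ↦ hνA i trivial, fun ν' hν' ↦ ?_⟩
  rcases le_total (meanFieldKL μ ν') (meanFieldKL μ ν₀) with h | h
  · exact hν ⟨fun i _ ↦ hν' i, h⟩
  · exact hνle.trans h
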